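/- Let $p\ge 1$. A multivalued operator on $\mathbb R^2$ (identified with its graph $T\subset\mathbb R^2\times\mathbb R^2$) is \emph{$p$-cyclically monotone} if $\sum_{i=0}^{p}\langle x_{i+1}-x_i,x_i^*\rangle\le 0$ for all $(x_0,x_0^*),\dots,(x_p,x_p^*)\in T$, where $x_{p+1}=x_0$, and \emph{maximal} $p$-cyclically monotone if moreover its graph is not properly contained in the graph of another $p$-cyclically monotone operator. Its \emph{$p$-polar} $T^{\mu_p}$ is the set of all $(x_0,x_0^*)$ such that $\sum_{i=0}^{p}\langle x_{i+1}-x_i,x_i^*\rangle\le 0$ for all $(x_1,x_1^*),\dots,(x_p,x_p^*)\in T$, where again $x_{p+1}=x_0$. Take the starting points $$\begin{aligned} x_1&=(0,0),&x_1^*&=(-1,-\tfrac12),\qquad & x_2&=(1,0),&x_2^*&=(0,1),\\ x_3&=(0,1),&x_3^*&=(-1,0),& x_4&=(-1,0),&x_4^*&=(-2,-2),\\ x_5&=(0,-1),&x_5^*&=(0,-1), \end{aligned}$$ and put $T_0=\{(x_i,x_i^*):1\le i\le 5\}$, $T_k=\big(\{x_k\}\times T_{k-1}^{\mu_2}(x_k)\big)\cup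 T_{k-1}$ for $k=1,\dots,5$, and $T_6=T_5^{\mu_2}$. Then the following hold. (1) $T_6$ is the operator given explicitly by $$\begin{aligned} T_6(0,0)&=\{-1\}\times[-1,0],\\ T_6(1,0)&=\{(u,v):u\ge 0,\ -1-u\le v\le 1+u\},\\ T_6(0,1)&=\{(u,v):v\ge 0,\ -2-v\le u\le v-1\},\\ T_6(-1,0)&=\{(u,v):u\le -2,\ u\le v\le -2-u\},\\ T_6(0,-1)&=\{(u,v):v\le -1,\ v\le u\le -1-v\}, \end{aligned}$$ for all $t\in(0,1)$, $$\begin{aligned} T_6(1-t,t)&=\{(u,v):v=1+u,\ u\ge\max\{-2t,-1\}\},\\ T_6(-t,1-t)&=\{(u,v):u+v=-2,\ u\le -2\},\\ T_6(t-1,-t)&=\{(u,v):v=u,\ u\le\min\{2t-2,-1\}\},\\ T_6(t,t-1)&=\{(u,v):u+v=-1,\ v\le -1\}, \end{aligned}$$ and $$T_6(0,\alpha)=\begin{cases}[-\alpha-1,-1]\times\{0\}&\text{if }0<\alpha<1,\\ [-1,-\alpha-1]\times\{-1\}&\text{if }-1<\alpha<0,\end{cases}\qquad T_6(x,y)=\begin{cases}\{(-1,0)\}&\text{if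 }0<x\le y<1-x,\\ \{(-1,-1)\}&\text{if }-1-x<y\le x<0,\end{cases}$$ and $T_6(x,y)=\emptyset$ for all other $(x,y)$. (2) The domain $\{z: T_6(z)\neq\emptyset\}$ of $T_6$ is the union of the diamond boundary $\{|x|+|y|=1\}$, the segment $\{0\}\times(-1,1)$, and the two closed triangles $\{0\le x\le y\le 1-x\}$ and $\{-1-x\le y\le x\le 0\}$. (3) $T_6$ is maximal 2-cyclically monotone. (4) $T_6$ is not maximal monotone, i.e. it is not a maximal element, with respect to inclusion of graphs, among the operators $T$ with $\langle x-y,x^*-y^*\rangle\ge 0$ for all $(x,x^*),(y,y^*)\in T$. -/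

import Mathlib

namespace CyclicMono

section General

variable {X : Type*} [NormedAddCommGroup X] [InnerProductSpace ℝ X]

/-- The domain of a multivalued operator on `X`.  Operators are identified with their graphs, so
an operator is a set of pairs `(x, x*)`, and the dual of the Hilbert space `X` is `X` itself. -/
def dom (T : Set (X × X)) : Set X := {x | ∃ xs, (x, xs) ∈ T}

/-- Monotone operators. -/
def IsMonotone (T : Set (X × X)) : Prop :=
  ∀ a ∈ T, ∀ b ∈ T, 0 ≤ inner ℝ (a.1 - b.1) (a.2 - b.2)

/-- The cyclic sum `∑ ⟨x_{i+1} - x_i, x_i*⟩` over `i = 0, …, p`, with `x_{p+1} = x_0`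
(the addition in `Fin (p + 1)` is cyclic). -/
noncomputable def cycleSum (p : ℕ) (z : Fin (p + 1) → X × X) : ℝ :=
  ∑ i, inner ℝ ((z (i + 1)).1 - (z i).1) (z i).2

/-- `p`-cyclically monotone operators. -/
def IsCyclicallyMonotone (p : ℕ) (T : Set (X × X)) : Prop :=
  ∀ z : Fin (p + 1) → X × X, (∀ i, z i ∈ T) → cycleSum p z ≤ 0

/-- Maximal `p`-cyclically monotone operators: the graph is not properly contained in the graph
of another `p`-cyclically monotone operator. -/
def IsMaximalCyclicallyMonotone (p : ℕ) (T : Set (X × X)) : Prop :=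
  Maximal (IsCyclicallyMonotone p) T

/-- The `p`-cyclically monotone polar of `T`: all `z_0` whose cyclic sums with any
`z_1, …, z_p` in `T` are nonpositive. -/
def polar (p : ℕ) (T : Set (X × X)) : Set (X × X) :=
  {w | ∀ z : Fin (p + 1) → X × X, z 0 = w → (∀ i, i ≠ 0 → z i ∈ T) → cycleSum p z ≤ 0}

/-- One step of the construction: add to `T` the whole image of `x` under the polar of `T`. -/
def polarStep (p : ℕ) (T : Set (X × X)) (x : X) : Set (X × X) :=
  {w | w.1 = x ∧ w ∈ polar p T} ∪ T

/-- The last step operator of the construction with starting points `L = [z_1, …, z_n]`: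
`T_0 = {z_1, …, z_n}`, `T_k` is obtained from `T_{k-1}` by a step at `x_k` for `k = 1, …, n`,
and `T_{n+1}` is the polar of `T_n`. -/
def lastStep (p : ℕ) (L : List (X × X)) : Set (X × X) :=
  polar p (L.foldl (fun T z => polarStep p T z.1) {z | z ∈ L})

end General

/-- The Euclidean plane. -/
abbrev Plane : Type := EuclideanSpace ℝ (Fin 2)

/-- The five starting points `(x_i, x_i*)`. -/
noncomputable def startPoints : List (Plane × Plane) :=
  [(!₂[0, 0], !₂[-1, -1 / 2]),
   (!₂[1, 0], !₂[0, 1]),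
   (!₂[0, 1], !₂[-1, 0]),
   (!₂[-1, 0], !₂[-2, -2]),
   (!₂[0, -1], !₂[0, -1])]

/-- The correspondence rule of the operator: `(u, v)` belongs to the image of `(x, y)`. -/
def Rule (x y u v : ℝ) : Prop :=
  -- the five starting points
  (x = 0 ∧ y = 0 ∧ u = -1 ∧ -1 ≤ v ∧ v ≤ 0) ∨
  (x = 1 ∧ y = 0 ∧ 0 ≤ u ∧ -1 - u ≤ v ∧ v ≤ 1 + u) ∨
  (x = 0 ∧ y = 1 ∧ 0 ≤ v ∧ -2 - v ≤ u ∧ u ≤ v - 1) ∨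
  (x = -1 ∧ y = 0 ∧ u ≤ -2 ∧ u ≤ v ∧ v ≤ -2 - u) ∨
  (x = 0 ∧ y = -1 ∧ v ≤ -1 ∧ v ≤ u ∧ u ≤ -1 - v) ∨
  -- the open sides of the diamond
  (∃ t : ℝ, 0 < t ∧ t < 1 ∧ x = 1 - t ∧ y = t ∧ v = 1 + u ∧ max (-2 * t) (-1) ≤ u) ∨
  (∃ t : ℝ, 0 < t ∧ t < 1 ∧ x = -t ∧ y = 1 - t ∧ u + v = -2 ∧ u ≤ -2) ∨
  (∃ t : ℝ, 0 < t ∧ t < 1 ∧ x = t - 1 ∧ y = -t ∧ v = u ∧ u ≤ min (2 * t - 2) (-1)) ∨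
  (∃ t : ℝ, 0 < t ∧ t < 1 ∧ x = t ∧ y = t - 1 ∧ u + v = -1 ∧ v ≤ -1) ∨
  -- the vertical segment without its end points and the origin
  (x = 0 ∧ 0 < y ∧ y < 1 ∧ -y - 1 ≤ u ∧ u ≤ -1 ∧ v = 0) ∨
  (x = 0 ∧ -1 < y ∧ y < 0 ∧ -1 ≤ u ∧ u ≤ -y - 1 ∧ v = -1) ∨
  -- the rest of the two triangles
  (0 < x ∧ x ≤ y ∧ y < 1 - x ∧ u = -1 ∧ v = 0) ∨
  (-1 - x < y ∧ y ≤ x ∧ x < 0 ∧ u = -1 ∧ v = -1)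

/-- The explicit operator `T₆` on the plane. -/
def T6 : Set (Plane × Plane) := {z | Rule (z.1 0) (z.1 1) (z.2 0) (z.2 1)}

end CyclicMono

namespace CyclicMono

/-! With two points of a triple fixed, the cyclic sum is affine in `(x, x*, ⟨x, x*⟩)` of the third.
Lifted to these coordinates, each graph point is a convex combination of the twelve points of
`core`, plus a normal direction of the diamond at `x` when `x` lies on its boundary. Along such a
direction the sum cannot increase, because the coefficient of `x*` comes from a point of the
diamond. So 2-cyclic monotonicity reduces to a finite check (`T6_cyclic`).

Conversely, the unbounded images of the vertices confine the polar to the diamond, and finitely many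
triples then cut it down to the operator (`polar_subset_T6`). These two facts give both the last
step of the construction and maximality. Maximal monotonicity fails because a point over `(1/2, 0)`,
outside the domain, is monotonically related to the whole graph. -/

/-- The point of the graph space with the given coordinates. -/
noncomputable def mkPt (x y u v : ℝ) : Plane × Plane := (!₂[x, y], !₂[u, v])

/-- The cyclic sum over a triangle, in coordinates. -/
def triSum (a b c : Plane × Plane) : ℝ :=
  (b.1 0 - a.1 0) * a.2 0 + (b.1 1 - a.1 1) * a.2 1 +
  ((c.1 0 - b.1 0) * b.2 0 + (c.1 1 - b.1 1) * b.2 1) +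
  ((a.1 0 - c.1 0) * c.2 0 + (a.1 1 - c.1 1) * c.2 1)

/-! ### Cyclic sums over triples and the 2-polar in coordinates -/

theorem inner_plane (a b : Plane) : inner ℝ a b = a 0 * b 0 + a 1 * b 1 := by
  simp [PiLp.inner_apply, Fin.sum_univ_two, mul_comm]

theorem cycleSum_two (z : Fin 3 → Plane × Plane) :
    cycleSum 2 z = triSum (z 0) (z 1) (z 2) := by
  have h : cycleSum 2 z = inner ℝ ((z 1).1 - (z 0).1) (z 0).2 +
      inner ℝ ((z 2).1 - (z 1).1) (z 1).2 + inner ℝ ((z 0).1 - (z 2).1) (z 2).2 :=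
    Fin.sum_univ_three _
  simp only [h, inner_plane, triSum, PiLp.sub_apply]

theorem mem_polar_two {T : Set (Plane × Plane)} {w : Plane × Plane} :
    w ∈ polar 2 T ↔ ∀ a ∈ T, ∀ b ∈ T, triSum w a b ≤ 0 := by
  constructor
  · intro h a ha b hb
    have := h ![w, a, b] rfl (by
      intro i hi
      fin_cases i
      · exact absurd rfl hi
      · exact ha
      · exact hb)
    rwa [cycleSum_two] at this
  · intro h z hz hT
    rw [cycleSum_two, hz]
    exact h _ (hT 1 (by decide)) _ (hT 2 (by decide))

theorem isCyclicallyMonotone_two {T : Set (Plane × Plane)} :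
    IsCyclicallyMonotone 2 T ↔ ∀ a ∈ T, ∀ b ∈ T, ∀ c ∈ T, triSum a b c ≤ 0 := by
  constructor
  · intro h a ha b hb c hc
    have := h ![a, b, c] (by
      intro i
      fin_cases i
      · exact ha
      · exact hb
      · exact hc)
    rwa [cycleSum_two] at this
  · intro h z hz
    rw [cycleSum_two]
    exact h _ (hz 0) _ (hz 1) _ (hz 2)

theorem polar_anti {T S : Set (Plane × Plane)} (h : T ⊆ S) : polar 2 S ⊆ polar 2 T := by
  intro w hw
  rw [mem_polar_two] at *
  exact fun a ha b hb => hw a (h ha) b (h hb)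

/-! ### The finite core of the operator -/

/-- Twelve points of the graph, with doubled positions. -/
def core : List (ℤ × ℤ × ℤ × ℤ) :=
  [(0, 0, -1, -1), (0, 0, -1, 0), (2, 0, 0, 1), (2, 0, 0, -1), (0, 2, -1, 0), (0, 2, -2, 0),
   (-2, 0, -2, -2), (-2, 0, -2, 0), (0, -2, 0, -1), (0, -2, -1, -1),
   (1, 1, -1, 0), (-1, -1, -1, -1)]

-- Doubling the positions makes all entries integers, so the 12³ triples can be decided by
-- evaluation.
set_option maxRecDepth 20000 in
theorem core_cyclic : ∀ a ∈ core, ∀ b ∈ core, ∀ c ∈ core,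
    (b.1 - a.1) * a.2.2.1 + (b.2.1 - a.2.1) * a.2.2.2 +
    ((c.1 - b.1) * b.2.2.1 + (c.2.1 - b.2.1) * b.2.2.2) +
    ((a.1 - c.1) * c.2.2.1 + (a.2.1 - c.2.1) * c.2.2.2) ≤ 0 := by
  decide

/-- The point of the graph space that an element of `core` stands for. -/
noncomputable def corePt (k : ℤ × ℤ × ℤ × ℤ) : Plane × Plane :=
  mkPt (k.1 / 2) (k.2.1 / 2) k.2.2.1 k.2.2.2

theorem triSum_core {a b c : ℤ × ℤ × ℤ × ℤ} (ha : a ∈ core) (hb : b ∈ core) (hc : c ∈ core) :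
    triSum (corePt a) (corePt b) (corePt c) ≤ 0 := by
  have h := core_cyclic a ha b hb c hc
  have h' : (((b.1 - a.1) * a.2.2.1 + (b.2.1 - a.2.1) * a.2.2.2 +
    ((c.1 - b.1) * b.2.2.1 + (c.2.1 - b.2.1) * b.2.2.2) +
    ((a.1 - c.1) * c.2.2.1 + (a.2.1 - c.2.1) * c.2.2.2) : ℤ) : ℝ) ≤ 0 := by exact_mod_cast h
  push_cast at h'
  simp only [triSum, corePt, mkPt, PiLp.toLp_apply, Matrix.cons_val_zero, Matrix.cons_val_one]
  linarith

/-- The closed unit ball of the `ℓ¹` norm. -/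
def Diamond (x y : ℝ) : Prop := x + y ≤ 1 ∧ x - y ≤ 1 ∧ -x + y ≤ 1 ∧ -x - y ≤ 1

theorem Rule.diamond {x y u v : ℝ} (h : Rule x y u v) : Diamond x y := by
  unfold Diamond
  rcases h with h | h | h | h | h | ⟨t, h⟩ | ⟨t, h⟩ | ⟨t, h⟩ | ⟨t, h⟩ | h | h | h | h <;>
    refine ⟨?_, ?_, ?_, ?_⟩ <;> linarith [h.1, h.2.1, h.2.2.1, h.2.2.2.1]

theorem corePt_diamond {k : ℤ × ℤ × ℤ × ℤ} (hk : k ∈ core) :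
    Diamond ((corePt k).1 0) ((corePt k).1 1) := by
  simp only [core, List.mem_cons, List.not_mem_nil, or_false] at hk
  rcases hk with rfl | rfl | rfl | rfl | rfl | rfl | rfl | rfl | rfl | rfl | rfl | rfl <;>
    norm_num [Diamond, corePt, mkPt]

/-- An inequality that is affine in `(x, x*, ⟨x, x*⟩)` and holds on the core holds on the whole
graph, provided that the coefficient of `x*` lies in the diamond. -/
theorem Rule.le_of_core {x y u v p q a b c : ℝ} (h : Rule x y u v) (hpq : Diamond p q)
    (hc : ∀ k ∈ core, p * k.2.2.1 + q * k.2.2.2 + a * (k.1 / 2) + b * (k.2.1 / 2)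
      - (k.1 / 2 * k.2.2.1 + k.2.1 / 2 * k.2.2.2) + c ≤ 0) :
    p * u + q * v + a * x + b * y - (x * u + y * v) + c ≤ 0 := by
  simp only [core, List.forall_mem_cons, List.not_mem_nil, false_imp_iff, implies_true] at hc
  norm_num at hc
  obtain ⟨h1, h2, h3, h4, h5, h6, h7, h8, h9, h10, h11, h12⟩ := hc
  obtain ⟨d1, d2, d3, d4⟩ := hpq
  have comb : ∀ {r s : ℝ}, 0 ≤ r → s ≤ 0 → r * s ≤ 0 := mul_nonpos_of_nonneg_of_nonpos
  rcases h with h | h | h | h | h | ⟨t, h⟩ | ⟨t, h⟩ | ⟨t, h⟩ | ⟨t, h⟩ | h | h | h | h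
  · obtain ⟨rfl, rfl, rfl, h, h'⟩ := h
    linarith [comb (sub_nonneg.2 h) (sub_nonpos.2 h2), comb (sub_nonneg.2 h') h1]
  · obtain ⟨rfl, rfl, h, h', h''⟩ := h
    -- The sign of `q` selects the boundary ray of the image on which the affine function is
    -- largest; `d1` or `d2` controls its slope along that ray.
    rcases le_total 0 q with hq | hq
    · linarith [comb hq (sub_nonpos.2 h''), comb h (sub_nonpos.2 d1)]
    · linarith [comb (neg_nonneg.2 hq) (sub_nonpos.2 h'), comb h (sub_nonpos.2 d2)]
  · obtain ⟨rfl, rfl, h, h', h''⟩ := h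
    rcases le_total 0 p with hp | hp
    · linarith [comb hp (sub_nonpos.2 h''), comb h (sub_nonpos.2 d1)]
    · linarith [comb (neg_nonneg.2 hp) (sub_nonpos.2 h'), comb h (sub_nonpos.2 d3)]
  · obtain ⟨rfl, rfl, h, h', h''⟩ := h
    rcases le_total 0 q with hq | hq
    · linarith [comb hq (sub_nonpos.2 h''), comb (sub_nonneg.2 h) (sub_nonpos.2 d3)]
    · linarith [comb (neg_nonneg.2 hq) (sub_nonpos.2 h'), comb (sub_nonneg.2 h) (sub_nonpos.2 d4)]
  · obtain ⟨rfl, rfl, h, h', h''⟩ := h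
    rcases le_total 0 p with hp | hp
    · linarith [comb hp (sub_nonpos.2 h''), comb (sub_nonneg.2 h) (sub_nonpos.2 d2)]
    · linarith [comb (neg_nonneg.2 hp) (sub_nonpos.2 h'), comb (sub_nonneg.2 h) (sub_nonpos.2 d4)]
  · obtain ⟨ht, ht', rfl, rfl, rfl, h⟩ := h
    obtain ⟨h, h'⟩ := max_le_iff.1 h
    -- The bound `max (-2t) (-1)` has its kink at the core point over `(1/2, 1/2)`. On either side
    -- of it the lifted boundary point is affine in `t`.
    rcases le_total (2 * y) 1 with ht2 | ht2
    · linarith [comb (sub_nonneg.2 h) (sub_nonpos.2 d1), comb (sub_nonneg.2 ht2) h3,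
        comb ht.le h11]
    · linarith [comb (sub_nonneg.2 h') (sub_nonpos.2 d1), comb (sub_nonneg.2 ht2) h5,
        comb (sub_nonneg.2 ht'.le) h11]
  · obtain ⟨ht, ht', rfl, rfl, h, h'⟩ := h
    obtain rfl : v = -2 - u := by linarith
    linarith [comb (sub_nonneg.2 h') (sub_nonpos.2 d3), comb ht.le h8,
      comb (sub_nonneg.2 ht'.le) h6]
  · obtain ⟨ht, ht', rfl, rfl, rfl, h⟩ := h
    obtain ⟨h, h'⟩ := le_min_iff.1 h
    rcases le_total (2 * t) 1 with ht2 | ht2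
    · linarith [comb (sub_nonneg.2 h) (sub_nonpos.2 d4), comb (sub_nonneg.2 ht2) h7,
        comb ht.le h12]
    · linarith [comb (sub_nonneg.2 h') (sub_nonpos.2 d4), comb (sub_nonneg.2 ht2) h10,
        comb (sub_nonneg.2 ht'.le) h12]
  · obtain ⟨ht, ht', rfl, rfl, h, h'⟩ := h
    obtain rfl : u = -1 - v := by linarith
    linarith [comb (sub_nonneg.2 h') (sub_nonpos.2 d2), comb ht.le h4,
      comb (sub_nonneg.2 ht'.le) h9]
  · obtain ⟨rfl, hy, hy', h, h', rfl⟩ := h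
    rcases le_total 0 p with hp | hp
    · linarith [comb hp (sub_nonpos.2 h'), comb hy.le h5,
        comb (sub_nonneg.2 hy'.le) (sub_nonpos.2 h2)]
    · linarith [comb (neg_nonneg.2 hp) (sub_nonpos.2 h), comb hy.le h6,
        comb (sub_nonneg.2 hy'.le) (sub_nonpos.2 h2)]
  · obtain ⟨rfl, hy, hy', h, h', rfl⟩ := h
    rcases le_total 0 p with hp | hp
    · linarith [comb hp (sub_nonpos.2 h'), comb (neg_nonneg.2 hy'.le) h9,
        comb (sub_nonneg.2 hy.le) h1]
    · linarith [comb (neg_nonneg.2 hp) (sub_nonpos.2 h), comb (neg_nonneg.2 hy'.le) h10,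
        comb (sub_nonneg.2 hy.le) h1]
  · obtain ⟨hx, hxy, hy, rfl, rfl⟩ := h
    linarith [comb hx.le h11, comb (sub_nonneg.2 hxy) h5,
      comb (sub_nonneg.2 hy.le) (sub_nonpos.2 h2)]
  · obtain ⟨hx, hxy, hy, rfl, rfl⟩ := h
    linarith [comb (neg_nonneg.2 hy.le) h12, comb (sub_nonneg.2 hxy) h10,
      comb (sub_nonneg.2 hx.le) h1]

theorem triSum_rotate (a b c : Plane × Plane) : triSum a b c = triSum b c a := by
  simp only [triSum]; ring

theorem triSum_le_of_core {w a b : Plane × Plane} (hw : w ∈ T6) (ha : Diamond (a.1 0) (a.1 1))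
    (h : ∀ k ∈ core, triSum (corePt k) a b ≤ 0) : triSum w a b ≤ 0 := by
  have := Rule.le_of_core (a := b.2 0) (b := b.2 1)
    (c := (b.1 0 - a.1 0) * a.2 0 + (b.1 1 - a.1 1) * a.2 1 - b.1 0 * b.2 0 - b.1 1 * b.2 1)
    hw ha (by
      intro k hk
      have := h k hk
      simp only [triSum, corePt, mkPt, PiLp.toLp_apply, Matrix.cons_val_zero,
        Matrix.cons_val_one] at this
      linarith)
  simp only [triSum]
  linarith

/-- The three points are replaced by core points one at a time; each replacement only needs the next
point of the cycle to lie over the diamond. -/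
theorem T6_cyclic {a b c : Plane × Plane} (ha : a ∈ T6) (hb : b ∈ T6) (hc : c ∈ T6) :
    triSum a b c ≤ 0 := by
  refine triSum_le_of_core ha hb.diamond fun k hk => ?_
  rw [triSum_rotate]
  refine triSum_le_of_core hb hc.diamond fun l hl => ?_
  rw [triSum_rotate]
  refine triSum_le_of_core hc (corePt_diamond hk) fun m hm => ?_
  exact triSum_core hm hk hl


/-! ### Symmetry and the polar of the vertices -/

/-- Cyclic sums are unchanged by negating all points and by translating all `x*`. This symmetry
reduces the lower half of the diamond to the upper one. -/
theorem Rule.reflect {x y u v : ℝ} (h : Rule (-x) (-y) (-2 - u) (-1 - v)) : Rule x y u v := by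
  unfold Rule
  rcases h with h | h | h | h | h | ⟨t, h⟩ | ⟨t, h⟩ | ⟨t, h⟩ | ⟨t, h⟩ | h | h | h | h
  · left
    refine ⟨?_, ?_, ?_, ?_, ?_⟩ <;> linarith
  · iterate 3 right
    left
    refine ⟨?_, ?_, ?_, ?_, ?_⟩ <;> linarith
  · iterate 4 right
    left
    refine ⟨?_, ?_, ?_, ?_, ?_⟩ <;> linarith
  · iterate 1 right
    left
    refine ⟨?_, ?_, ?_, ?_, ?_⟩ <;> linarith
  · iterate 2 right
    left
    refine ⟨?_, ?_, ?_, ?_, ?_⟩ <;> linarith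
  · iterate 7 right
    left
    obtain ⟨h1, h2, h3, h4, h5, h6⟩ := h
    obtain ⟨h6, h7⟩ := max_le_iff.1 h6
    refine ⟨t, ?_, ?_, ?_, ?_, ?_, le_min ?_ ?_⟩ <;> linarith
  · iterate 8 right
    left
    refine ⟨t, ?_, ?_, ?_, ?_, ?_, ?_⟩ <;> linarith
  · iterate 5 right
    left
    obtain ⟨h1, h2, h3, h4, h5, h6⟩ := h
    obtain ⟨h6, h7⟩ := le_min_iff.1 h6
    refine ⟨t, ?_, ?_, ?_, ?_, ?_, max_le ?_ ?_⟩ <;> linarith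
  · iterate 6 right
    left
    refine ⟨t, ?_, ?_, ?_, ?_, ?_, ?_⟩ <;> linarith
  · iterate 10 right
    left
    refine ⟨?_, ?_, ?_, ?_, ?_, ?_⟩ <;> linarith
  · iterate 9 right
    left
    refine ⟨?_, ?_, ?_, ?_, ?_, ?_⟩ <;> linarith
  · iterate 12 right
    refine ⟨?_, ?_, ?_, ?_, ?_⟩ <;> linarith
  · iterate 11 right
    left
    refine ⟨?_, ?_, ?_, ?_, ?_⟩ <;> linarith

/-- The inequalities between a point of the upper half of the diamond and the vertices determine
the operator there. -/
theorem Rule.of_upper {x y u v : ℝ} (hd : Diamond x y) (hy : 0 ≤ y)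
    (h0 : -x ≤ x * u + y * v) (h0' : -y ≤ x * u + y * v) (h0'' : -2 * x ≤ x * u + y * v)
    (h1 : u + 1 - x ≤ x * u + y * v) (h2 : v - x ≤ x * u + y * v)
    (h2' : v - 2 * x ≤ x * u + y * v) (h3 : -u - 1 - y ≤ x * u + y * v)
    (h3' : -u - 1 - x - y ≤ x * u + y * v) (h4 : -v + y - 1 ≤ x * u + y * v)
    (h4' : -v - 1 - x ≤ x * u + y * v) : Rule x y u v := by
  obtain ⟨d1, d2, d3, d4⟩ := hd
  rcases lt_trichotomy x 0 with hx | rfl | hx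
  · have hxy : y = 1 + x := by
      by_contra hne
      have hlt : 0 < 1 + x - y := lt_of_le_of_ne (by linarith) fun h => hne (by linarith)
      -- The weights `1 + x - y`, `-x`, `y` sum to 1 and eliminate `u` and `v`; what remains is `-x
      -- * (1 + x - y) ≤ 0`.
      have := mul_pos (neg_pos.2 hx) hlt
      have e0 := mul_le_mul_of_nonneg_left h0'' hlt.le
      have e3 := mul_le_mul_of_nonneg_left h3' (neg_pos.2 hx).le
      have e2 := mul_le_mul_of_nonneg_left h2' hy
      linarith
    subst hxy
    rcases hy.eq_or_lt with hy | hy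
    · obtain rfl : x = -1 := by linarith
      iterate 3 right
      left
      refine ⟨rfl, ?_, ?_, ?_, ?_⟩ <;> linarith
    · have ha : 0 ≤ u + v + 2 := nonneg_of_mul_nonneg_right (a := 1 + x) (by linarith) hy
      have hb : 0 ≤ -(u + v + 2) :=
        nonneg_of_mul_nonneg_right (a := -x) (by linarith) (neg_pos.2 hx)
      obtain rfl : v = -2 - u := by linarith
      iterate 6 right
      left
      refine ⟨-x, ?_, ?_, ?_, ?_, ?_, ?_⟩ <;> linarith
  · rcases hy.eq_or_lt with rfl | hy
    · left
      refine ⟨rfl, rfl, ?_, ?_, ?_⟩ <;> linarith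
    rcases (show y ≤ 1 by linarith).eq_or_lt with rfl | hy1
    · iterate 2 right
      left
      refine ⟨rfl, rfl, ?_, ?_, ?_⟩ <;> linarith
    · have ha : 0 ≤ v := nonneg_of_mul_nonneg_right (a := y) (by linarith) hy
      have hb : 0 ≤ -v := nonneg_of_mul_nonneg_right (a := 1 - y) (by linarith) (by linarith)
      obtain rfl : v = 0 := by linarith
      iterate 9 right
      left
      refine ⟨rfl, hy, hy1, ?_, ?_, rfl⟩ <;> linarith
  · rcases d1.eq_or_lt with hs | hs
    · obtain rfl : x = 1 - y := by linarith
      rcases hy.eq_or_lt with rfl | hy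
      · right
        left
        refine ⟨?_, rfl, ?_, ?_, ?_⟩ <;> linarith
      · have ha : 0 ≤ v - u - 1 := nonneg_of_mul_nonneg_right (a := y) (by linarith) hy
        have hb : 0 ≤ -(v - u - 1) := nonneg_of_mul_nonneg_right (a := 1 - y) (by linarith) hx
        obtain rfl : v = 1 + u := by linarith
        iterate 5 right
        left
        refine ⟨y, hy, ?_, rfl, rfl, rfl, max_le ?_ ?_⟩ <;> linarith
    · have hs' : 0 < 1 - x - y := by linarith
      -- With weights `x`, `y`, `1 - x - y`, the inequalities `h1`, `h2`, `h0'` force `x ≤ y`. With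
      -- `h0` in place of `h0'` the weighted sum is an identity, so all three are tight, giving `u =
      -- -1` and `v = 0`.
      have e1 := mul_le_mul_of_nonneg_left h1 hx.le
      have e2 := mul_le_mul_of_nonneg_left h2 hy
      have hxy : x ≤ y := by
        have e0 := mul_le_mul_of_nonneg_left h0' hs'.le
        have : 0 ≤ (1 - x - y) * (y - x) := by linarith
        linarith [nonneg_of_mul_nonneg_right this hs']
      have hy0 : 0 < y := by linarith
      have e0 := mul_le_mul_of_nonneg_left h0 hs'.le
      have hw : 0 ≤ -(x * u + y * v + x) :=
        nonneg_of_mul_nonneg_right (a := 1 - x - y) (by linarith) hs'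
      have pu : 0 ≤ x * -(u + 1) := mul_nonneg hx.le (by linarith)
      have pv : 0 ≤ y * -v := mul_nonneg hy (by linarith)
      have hu : 0 ≤ u + 1 := nonneg_of_mul_nonneg_right (a := x) (by linarith) hx
      have hv : 0 ≤ v := nonneg_of_mul_nonneg_right (a := y) (by linarith) hy0
      iterate 11 right
      left
      refine ⟨hx, hxy, ?_, ?_, ?_⟩ <;> linarith

theorem mkPt_mem_T6 {x y u v : ℝ} : mkPt x y u v ∈ T6 ↔ Rule x y u v := Iff.rfl

theorem mkPt_eta (w : Plane × Plane) : mkPt (w.1 0) (w.1 1) (w.2 0) (w.2 1) = w := by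
  ext i <;> fin_cases i <;> rfl

theorem Rule.center {v : ℝ} (h : -1 ≤ v) (h' : v ≤ 0) : Rule 0 0 (-1) v :=
  Or.inl ⟨rfl, rfl, rfl, h, h'⟩

theorem Rule.right {u v : ℝ} (h : 0 ≤ u) (h' : -1 - u ≤ v) (h'' : v ≤ 1 + u) : Rule 1 0 u v :=
  Or.inr (Or.inl ⟨rfl, rfl, h, h', h''⟩)

theorem Rule.top {u v : ℝ} (h : 0 ≤ v) (h' : -2 - v ≤ u) (h'' : u ≤ v - 1) : Rule 0 1 u v :=
  Or.inr (Or.inr (Or.inl ⟨rfl, rfl, h, h', h''⟩))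

theorem Rule.left {u v : ℝ} (h : u ≤ -2) (h' : u ≤ v) (h'' : v ≤ -2 - u) : Rule (-1) 0 u v :=
  Or.inr (Or.inr (Or.inr (Or.inl ⟨rfl, rfl, h, h', h''⟩)))

theorem Rule.bottom {u v : ℝ} (h : v ≤ -1) (h' : v ≤ u) (h'' : u ≤ -1 - v) : Rule 0 (-1) u v :=
  Or.inr (Or.inr (Or.inr (Or.inr (Or.inl ⟨rfl, rfl, h, h', h''⟩))))

theorem triSum_mkPt_le {T : Set (Plane × Plane)} {x y u v x₁ y₁ u₁ v₁ x₂ y₂ u₂ v₂ : ℝ}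
    (hw : mkPt x y u v ∈ polar 2 T) (h₁ : mkPt x₁ y₁ u₁ v₁ ∈ T) (h₂ : mkPt x₂ y₂ u₂ v₂ ∈ T) :
    (x₁ - x) * u + (y₁ - y) * v + ((x₂ - x₁) * u₁ + (y₂ - y₁) * v₁) +
      ((x - x₂) * u₂ + (y - y₂) * v₂) ≤ 0 :=
  mem_polar_two.1 hw _ h₁ _ h₂

theorem nonpos_of_forall_mul_le {m C : ℝ} (h : ∀ n : ℝ, 0 ≤ n → m * n ≤ C) : m ≤ 0 := by
  by_contra! hm
  have h0 := h 0 le_rfl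
  have := h ((C + 1) / m) (div_nonneg (by linarith) hm.le)
  rw [mul_div_cancel₀ _ hm.ne'] at this
  linarith

/-- The polar of any set that contains the images of the five vertices lies in the operator. -/
theorem polar_subset_T6 {T : Set (Plane × Plane)}
    (hC : ∀ v : ℝ, Rule 0 0 (-1) v → mkPt 0 0 (-1) v ∈ T)
    (hR : ∀ u v : ℝ, Rule 1 0 u v → mkPt 1 0 u v ∈ T)
    (hU : ∀ u v : ℝ, Rule 0 1 u v → mkPt 0 1 u v ∈ T)
    (hL : ∀ u v : ℝ, Rule (-1) 0 u v → mkPt (-1) 0 u v ∈ T)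
    (hD : ∀ u v : ℝ, Rule 0 (-1) u v → mkPt 0 (-1) u v ∈ T) : polar 2 T ⊆ T6 := by
  intro w hw
  rw [← mkPt_eta w] at hw ⊢
  generalize w.1 0 = x, w.1 1 = y, w.2 0 = u, w.2 1 = v at hw
  rw [mkPt_mem_T6]
  have O1 := hC (-1) (.center (by norm_num) (by norm_num))
  have O2 := hC 0 (.center (by norm_num) (by norm_num))
  have R1 := hR 0 1 (.right (by norm_num) (by norm_num) (by norm_num))
  have U1 := hU (-1) 0 (.top (by norm_num) (by norm_num) (by norm_num))
  have U2 := hU (-2) 0 (.top (by norm_num) (by norm_num) (by norm_num))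
  have L1 := hL (-2) (-2) (.left (by norm_num) (by norm_num) (by norm_num))
  have D1 := hD 0 (-1) (.bottom (by norm_num) (by norm_num) (by norm_num))
  have D2 := hD (-1) (-1) (.bottom (by norm_num) (by norm_num) (by norm_num))
  have hd : Diamond x y := by
    refine ⟨?_, ?_, ?_, ?_⟩
    -- The vertex images contain rays in the four normal directions of the sides. Letting `n` grow
    -- along each ray gives one side of the diamond.
    · suffices x + y - 1 ≤ 0 by linarith
      refine nonpos_of_forall_mul_le (C := x * u + y * v - y + 1) fun n hn => ?_
      linarith [triSum_mkPt_le hw O2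
        (hR n (1 + n) (.right hn (by linarith) (by linarith)))]
    · suffices x - y - 1 ≤ 0 by linarith
      refine nonpos_of_forall_mul_le (C := x * u + y * v + y + 1) fun n hn => ?_
      linarith [triSum_mkPt_le hw O2
        (hR n (-1 - n) (.right hn (by linarith) (by linarith)))]
    · suffices -x + y - 1 ≤ 0 by linarith
      refine nonpos_of_forall_mul_le (C := x * u + y * v + 2 * x + 1) fun n hn => ?_
      linarith [triSum_mkPt_le hw O2
        (hL (-2 - n) n (.left (by linarith) (by linarith) (by linarith)))]
    · suffices -x - y - 1 ≤ 0 by linarith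
      refine nonpos_of_forall_mul_le (C := x * u + y * v + 2 * x + 2 * y + 1) fun n hn => ?_
      linarith [triSum_mkPt_le hw O2
        (hL (-2 - n) (-2 - n) (.left (by linarith) (by linarith) (by linarith)))]
  rcases le_total 0 y with hy | hy
  · exact Rule.of_upper hd hy
      (by linarith [triSum_mkPt_le hw O2 O2]) (by linarith [triSum_mkPt_le hw O1 D1])
      (by linarith [triSum_mkPt_le hw O2 U2]) (by linarith [triSum_mkPt_le hw R1 U1])
      (by linarith [triSum_mkPt_le hw U1 U1]) (by linarith [triSum_mkPt_le hw U2 U2])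
      (by linarith [triSum_mkPt_le hw L1 D1]) (by linarith [triSum_mkPt_le hw L1 D2])
      (by linarith [triSum_mkPt_le hw D1 R1]) (by linarith [triSum_mkPt_le hw D1 O2])
  · obtain ⟨d1, d2, d3, d4⟩ := hd
    -- The triples are the reflections of those used for the upper half.
    exact Rule.reflect <| Rule.of_upper
      ⟨by linarith, by linarith, by linarith, by linarith⟩ (by linarith)
      (by linarith [triSum_mkPt_le hw O1 O1]) (by linarith [triSum_mkPt_le hw O2 U2])
      (by linarith [triSum_mkPt_le hw O1 D1]) (by linarith [triSum_mkPt_le hw L1 D2])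
      (by linarith [triSum_mkPt_le hw D2 D2]) (by linarith [triSum_mkPt_le hw D1 D1])
      (by linarith [triSum_mkPt_le hw R1 U2]) (by linarith [triSum_mkPt_le hw R1 U1])
      (by linarith [triSum_mkPt_le hw U2 L1]) (by linarith [triSum_mkPt_le hw U2 O1])

/-! ### The construction -/

theorem T6_subset_polar {T : Set (Plane × Plane)} (hT : T ⊆ T6) : T6 ⊆ polar 2 T := fun _ hw =>
  mem_polar_two.2 fun _ ha _ hb => T6_cyclic hw (hT ha) (hT hb)

theorem subset_polarStep (T : Set (Plane × Plane)) (p : Plane) : T ⊆ polarStep 2 T p :=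
  Set.subset_union_right

/-- Any part of the operator has the whole operator in its polar, so a step never misses a point of
the image. -/
theorem mem_polarStep {T : Set (Plane × Plane)} (hT : T ⊆ T6) {x y u v : ℝ}
    (h : Rule x y u v) : mkPt x y u v ∈ polarStep 2 T !₂[x, y] :=
  Or.inl ⟨rfl, T6_subset_polar hT h⟩

theorem polarStep_subset_T6 {T : Set (Plane × Plane)} (hT : T ⊆ T6) {x y : ℝ}
    (h : ∀ u v, mkPt x y u v ∈ polar 2 T → Rule x y u v) : polarStep 2 T !₂[x, y] ⊆ T6 := by
  rintro w (⟨hw, hp⟩ | hw)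
  · have : w = mkPt x y (w.2 0) (w.2 1) := by
      rw [← mkPt_eta w, hw]; rfl
    rw [this] at hp ⊢
    exact h _ _ hp
  · exact hT hw

theorem lastStep_startPoints : lastStep 2 startPoints = T6 := by
  set T₀ : Set (Plane × Plane) := {z | z ∈ startPoints} with hT₀
  have s1 : mkPt 0 0 (-1) (-1 / 2) ∈ T₀ := by simp [hT₀, startPoints, mkPt]
  have s2 : mkPt 1 0 0 1 ∈ T₀ := by simp [hT₀, startPoints, mkPt]
  have s3 : mkPt 0 1 (-1) 0 ∈ T₀ := by simp [hT₀, startPoints, mkPt]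
  have s4 : mkPt (-1) 0 (-2) (-2) ∈ T₀ := by simp [hT₀, startPoints, mkPt]
  have s5 : mkPt 0 (-1) 0 (-1) ∈ T₀ := by simp [hT₀, startPoints, mkPt]
  have h₀ : T₀ ⊆ T6 := by
    intro w hw
    simp only [hT₀, startPoints, Set.mem_ofPred_eq, List.mem_cons, List.not_mem_nil,
      or_false] at hw
    rcases hw with rfl | rfl | rfl | rfl | rfl
    · exact Rule.center (by norm_num) (by norm_num)
    · exact Rule.right (by norm_num) (by norm_num) (by norm_num)
    · exact Rule.top (by norm_num) (by norm_num) (by norm_num)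
    · exact Rule.left (by norm_num) (by norm_num) (by norm_num)
    · exact Rule.bottom (by norm_num) (by norm_num) (by norm_num)
  set T₁ := polarStep 2 T₀ !₂[0, 0]
  have m₁ : T₀ ⊆ T₁ := subset_polarStep _ _
  -- At each vertex only the upper inclusion needs work: a few triples of starting points and points
  -- added earlier bound the new image.
  have h₁ : T₁ ⊆ T6 := polarStep_subset_T6 h₀ fun u v hw => by
    obtain rfl : u = -1 := by
      linarith [triSum_mkPt_le hw s2 s3, triSum_mkPt_le hw s4 s5]
    exact .center (by linarith [triSum_mkPt_le hw s5 s1]) (by linarith [triSum_mkPt_le hw s3 s3])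
  have O1 : mkPt 0 0 (-1) (-1) ∈ T₁ := mem_polarStep h₀ (.center (by norm_num) (by norm_num))
  have O2 : mkPt 0 0 (-1) 0 ∈ T₁ := mem_polarStep h₀ (.center (by norm_num) (by norm_num))
  set T₂ := polarStep 2 T₁ !₂[1, 0]
  have m₂ : T₁ ⊆ T₂ := subset_polarStep _ _
  have h₂ : T₂ ⊆ T6 := polarStep_subset_T6 h₁ fun u v hw =>
    .right (by linarith [triSum_mkPt_le hw O1 (m₁ s5)])
      (by linarith [triSum_mkPt_le hw (m₁ s5) (m₁ s5)])
      (by linarith [triSum_mkPt_le hw (m₁ s3) (m₁ s3)])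
  have R2 : mkPt 1 0 0 (-1) ∈ T₂ :=
    mem_polarStep h₁ (.right (by norm_num) (by norm_num) (by norm_num))
  set T₃ := polarStep 2 T₂ !₂[0, 1]
  have m₃ : T₂ ⊆ T₃ := subset_polarStep _ _
  have h₃ : T₃ ⊆ T6 := polarStep_subset_T6 h₂ fun u v hw =>
    .top (by linarith [triSum_mkPt_le hw (m₂ O2) (m₂ (m₁ s3))])
      (by linarith [triSum_mkPt_le hw (m₂ (m₁ s4)) (m₂ (m₁ s5))])
      (by linarith [triSum_mkPt_le hw (m₂ (m₁ s2)) (m₂ (m₁ s3))])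
  have U2 : mkPt 0 1 (-2) 0 ∈ T₃ :=
    mem_polarStep h₂ (.top (by norm_num) (by norm_num) (by norm_num))
  set T₄ := polarStep 2 T₃ !₂[-1, 0]
  have m₄ : T₃ ⊆ T₄ := subset_polarStep _ _
  have h₄ : T₄ ⊆ T6 := polarStep_subset_T6 h₃ fun u v hw =>
    .left (by linarith [triSum_mkPt_le hw (m₃ (m₂ O2)) U2])
      (by linarith [triSum_mkPt_le hw (m₃ (m₂ (m₁ s5))) (m₃ (m₂ O1))])
      (by linarith [triSum_mkPt_le hw U2 U2])
  set T₅ := polarStep 2 T₄ !₂[0, -1]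
  have m₅ : T₄ ⊆ T₅ := subset_polarStep _ _
  have h₅ : T₅ ⊆ T6 := polarStep_subset_T6 h₄ fun u v hw => by
    have O1 := m₄ (m₃ (m₂ O1))
    have R2 := m₄ (m₃ R2)
    have L1 := m₄ (m₃ (m₂ (m₁ s4)))
    exact .bottom (by linarith [triSum_mkPt_le hw O1 O1]) (by linarith [triSum_mkPt_le hw L1 L1])
      (by linarith [triSum_mkPt_le hw R2 R2])
  have hlast : lastStep 2 startPoints = polar 2 T₅ := rfl
  rw [hlast]
  refine (polar_subset_T6 ?_ ?_ ?_ ?_ ?_).antisymm (T6_subset_polar h₅)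
  · exact fun v h => m₅ (m₄ (m₃ (m₂ (mem_polarStep h₀ h))))
  · exact fun u v h => m₅ (m₄ (m₃ (mem_polarStep h₁ h)))
  · exact fun u v h => m₅ (m₄ (mem_polarStep h₂ h))
  · exact fun u v h => m₅ (mem_polarStep h₃ h)
  · exact fun u v h => mem_polarStep h₄ h

theorem isMaximalCyclicallyMonotone_T6 : IsMaximalCyclicallyMonotone 2 T6 := by
  refine ⟨isCyclicallyMonotone_two.2 fun _ ha _ hb _ hc => T6_cyclic ha hb hc, fun S hS h => ?_⟩
  -- A 2-cyclically monotone extension lies in the polar of the operator, hence in the operator.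
  have hS' : S ⊆ polar 2 T6 := fun w hw =>
    mem_polar_two.2 fun a ha b hb => isCyclicallyMonotone_two.1 hS _ hw _ (h ha) _ (h hb)
  refine fun w hw => polar_subset_T6 (T := T6) ?_ ?_ ?_ ?_ ?_ (hS' hw)
  all_goals intros; assumption

/-! ### The domain and failure of maximal monotonicity -/

theorem mem_dom_T6 {z : Plane} : z ∈ dom T6 ↔ ∃ u v, Rule (z 0) (z 1) u v :=
  ⟨fun ⟨w, hw⟩ => ⟨w 0, w 1, hw⟩, fun ⟨u, v, h⟩ => ⟨!₂[u, v], h⟩⟩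

theorem exists_rule_of_abs {x y : ℝ} (h : |x| + |y| = 1) : ∃ u v, Rule x y u v := by
  rcases eq_or_ne x 0 with rfl | hx
  · rw [abs_zero, zero_add] at h
    rcases eq_or_eq_neg_of_abs_eq h with rfl | rfl
    · exact ⟨-1, 0, .top (by norm_num) (by norm_num) (by norm_num)⟩
    · exact ⟨0, -1, .bottom (by norm_num) (by norm_num) (by norm_num)⟩
  rcases eq_or_ne y 0 with rfl | hy
  · rw [abs_zero, add_zero] at h
    rcases eq_or_eq_neg_of_abs_eq h with rfl | rfl
    · exact ⟨0, 0, .right (by norm_num) (by norm_num) (by norm_num)⟩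
    · exact ⟨-2, 0, .left (by norm_num) (by norm_num) (by norm_num)⟩
  unfold Rule
  rcases hx.lt_or_gt with hx | hx <;> rcases hy.lt_or_gt with hy | hy
  · rw [abs_of_neg hx, abs_of_neg hy] at h
    refine ⟨-2, -2, ?_⟩
    iterate 7 right
    left
    refine ⟨-y, ?_, ?_, ?_, ?_, ?_, le_min ?_ ?_⟩ <;> linarith
  · rw [abs_of_neg hx, abs_of_pos hy] at h
    refine ⟨-2, 0, ?_⟩
    iterate 6 right
    left
    refine ⟨-x, ?_, ?_, ?_, ?_, ?_, ?_⟩ <;> linarith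
  · rw [abs_of_pos hx, abs_of_neg hy] at h
    refine ⟨0, -1, ?_⟩
    iterate 8 right
    left
    refine ⟨x, ?_, ?_, ?_, ?_, ?_, ?_⟩ <;> linarith
  · rw [abs_of_pos hx, abs_of_pos hy] at h
    refine ⟨0, 1, ?_⟩
    iterate 5 right
    left
    refine ⟨y, ?_, ?_, ?_, ?_, ?_, max_le ?_ ?_⟩ <;> linarith

theorem exists_rule_of_segment {y : ℝ} (h : -1 < y) (h' : y < 1) : ∃ u v, Rule 0 y u v := by
  rcases lt_trichotomy y 0 with hy | rfl | hy
  · refine ⟨-1, -1, ?_⟩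
    unfold Rule
    iterate 10 right
    left
    refine ⟨rfl, ?_, ?_, ?_, ?_, rfl⟩ <;> linarith
  · exact ⟨-1, 0, .center (by norm_num) le_rfl⟩
  · refine ⟨-1, 0, ?_⟩
    unfold Rule
    iterate 9 right
    left
    refine ⟨rfl, ?_, ?_, ?_, ?_, rfl⟩ <;> linarith

theorem dom_T6 : dom T6 =
    {z : Plane | |z 0| + |z 1| = 1} ∪ {z : Plane | z 0 = 0 ∧ -1 < z 1 ∧ z 1 < 1} ∪
    {z : Plane | 0 ≤ z 0 ∧ z 0 ≤ z 1 ∧ z 1 ≤ 1 - z 0} ∪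
    {z : Plane | -1 - z 0 ≤ z 1 ∧ z 1 ≤ z 0 ∧ z 0 ≤ 0} := by
  ext z
  rw [mem_dom_T6]
  simp only [Set.mem_union, Set.mem_ofPred_eq]
  generalize z 0 = x, z 1 = y
  constructor
  · rintro ⟨u, v, h⟩
    rcases h with h | h | h | h | h | ⟨t, h⟩ | ⟨t, h⟩ | ⟨t, h⟩ | ⟨t, h⟩ | h | h | h | h
    · left; left; right
      refine ⟨h.1, ?_, ?_⟩ <;> linarith [h.2.1]
    · left; left; left
      rw [h.1, h.2.1]; norm_num
    · left; left; left
      rw [h.1, h.2.1]; norm_num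
    · left; left; left
      rw [h.1, h.2.1]; norm_num
    · left; left; left
      rw [h.1, h.2.1]; norm_num
    · left; left; left
      obtain ⟨h1, h2, rfl, rfl, -⟩ := h
      rw [abs_of_pos, abs_of_pos] <;> linarith
    · left; left; left
      obtain ⟨h1, h2, rfl, rfl, -⟩ := h
      rw [abs_of_neg, abs_of_pos] <;> linarith
    · left; left; left
      obtain ⟨h1, h2, rfl, rfl, -⟩ := h
      rw [abs_of_neg, abs_of_neg] <;> linarith
    · left; left; left
      obtain ⟨h1, h2, rfl, rfl, -⟩ := h
      rw [abs_of_pos, abs_of_neg] <;> linarith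
    · left; left; right
      refine ⟨h.1, ?_, ?_⟩ <;> linarith [h.2.1, h.2.2.1]
    · left; left; right
      refine ⟨h.1, ?_, ?_⟩ <;> linarith [h.2.1, h.2.2.1]
    · left; right
      exact ⟨h.1.le, h.2.1, h.2.2.1.le⟩
    · right
      exact ⟨h.1.le, h.2.1, h.2.2.1.le⟩
  · rintro (((h | ⟨rfl, h, h'⟩) | ⟨h1, h2, h3⟩) | ⟨h1, h2, h3⟩)
    · exact exists_rule_of_abs h
    · exact exists_rule_of_segment h h'
    · rcases h3.eq_or_lt with h3 | h3
      · refine exists_rule_of_abs ?_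
        rw [abs_of_nonneg h1, abs_of_nonneg] <;> linarith
      · rcases h1.eq_or_lt with rfl | h1
        · exact exists_rule_of_segment (by linarith) (by linarith)
        · refine ⟨-1, 0, ?_⟩
          unfold Rule
          iterate 11 right
          left
          exact ⟨h1, h2, h3, rfl, rfl⟩
    · rcases h1.eq_or_lt with h1 | h1
      · refine exists_rule_of_abs ?_
        rw [abs_of_nonpos h3, abs_of_nonpos] <;> linarith
      · rcases h3.eq_or_lt with rfl | h3
        · exact exists_rule_of_segment (by linarith) (by linarith)
        · refine ⟨-1, -1, ?_⟩
          unfold Rule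
          iterate 12 right
          exact ⟨h1, h2, h3, rfl, rfl⟩

theorem isMonotone_T6 : IsMonotone T6 := by
  intro a ha b hb
  -- A triple with a repeated point gives the monotonicity inequality.
  have := T6_cyclic ha hb hb
  simp only [triSum] at this
  simp only [inner_plane, PiLp.sub_apply]
  linarith

/-- The point of the graph space that can be added to the operator without losing monotonicity. -/
noncomputable def extraPt : Plane × Plane := mkPt (1 / 2) 0 (-1 / 2) (-1 / 2)

theorem extraPt_monotone {w : Plane × Plane} (hw : w ∈ T6) :
    0 ≤ (w.1 0 - 1 / 2) * (w.2 0 + 1 / 2) + w.1 1 * (w.2 1 + 1 / 2) := by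
  -- The inequality is affine in the lifted coordinates, with `x*`-coefficient `(1/2, 0)` in the
  -- diamond, so the core suffices again.
  have := Rule.le_of_core (p := 1 / 2) (q := 0) (a := -1 / 2) (b := -1 / 2) (c := 1 / 4) hw
    (by norm_num [Diamond]) (by
      simp only [core, List.forall_mem_cons, List.not_mem_nil, false_imp_iff, implies_true]
      norm_num)
  linarith

theorem extraPt_notMem : extraPt ∉ T6 := by
  intro h
  have h' : extraPt.1 ∈ dom T6 := ⟨_, h⟩
  rw [dom_T6] at h'
  norm_num [extraPt, mkPt] at h'

theorem not_maximal_isMonotone_T6 : ¬ Maximal IsMonotone T6 := by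
  intro hmax
  refine extraPt_notMem (hmax.2 (y := insert extraPt T6) ?_ (Set.subset_insert _ _)
    (Set.mem_insert _ _))
  rintro a (rfl | ha) b (rfl | hb)
  · simp
  · have := extraPt_monotone hb
    simp only [inner_plane, PiLp.sub_apply, extraPt, mkPt, Matrix.cons_val_zero,
      Matrix.cons_val_one]
    linarith
  · have := extraPt_monotone ha
    simp only [inner_plane, PiLp.sub_apply, extraPt, mkPt, Matrix.cons_val_zero,
      Matrix.cons_val_one]
    linarith
  · exact isMonotone_T6 a ha b hb

end CyclicMono

theorem mainTheorem9 :
    CyclicMono.lastStep 2 CyclicMono.startPoints = CyclicMono.T6 ∧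
    CyclicMono.dom CyclicMono.T6 =
      {z : CyclicMono.Plane | |z 0| + |z 1| = 1} ∪
      {z : CyclicMono.Plane | z 0 = 0 ∧ -1 < z 1 ∧ z 1 < 1} ∪
      {z : CyclicMono.Plane | 0 ≤ z 0 ∧ z 0 ≤ z 1 ∧ z 1 ≤ 1 - z 0} ∪
      {z : CyclicMono.Plane | -1 - z 0 ≤ z 1 ∧ z 1 ≤ z 0 ∧ z 0 ≤ 0} ∧
    CyclicMono.IsMaximalCyclicallyMonotone 2 CyclicMono.T6 ∧
    ¬ Maximal CyclicMono.IsMonotone CyclicMono.T6 :=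
  ⟨CyclicMono.lastStep_startPoints, CyclicMono.dom_T6,
    CyclicMono.isMaximalCyclicallyMonotone_T6, CyclicMono.not_maximal_isMonotone_T6⟩
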